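/- Fix an integer $k \ge 0$. Let $\mathcal{L}$ be the set of line segments joining consecutive integral points on the lines in $\mathbb{R}^2$ of slope $0$, $-1$ or $\infty$ through integral points. For coprime integers $p,q\ge 0$ let $\gamma$ be the straight segment oriented from $(0,0)$ to $(p,q)$, and let $\tau_1,\dots,\tau_N$ be the segments of $\mathcal{L}$ whose interiors $\gamma$ crosses transversally in an interior point of $\gamma$, in the order in which they are crossed. Let $\mathcal{P}_{(p,q)}$ be the poset on the elements $(\tau_j,i)$, $1\le j\le N$, $0\le i\le k$, whose order is generated by the following relations: $(\tau_j,0)\succ(\tau_j,1)\succ\dots\succ(\tau_j,k)$ if the crossing point is strictly closer to the endpoint of $\tau_j$ lying to the right of $\gamma$ than to the other endpoint, and $(\tau_j,0)\prec(\tau_j,1)\prec\dots\prec(\tau_j,k)$ otherwise; $(\tau_j,k)\succ(\tau_{j+1},0)$ if the common endpoint of $\tau_j$ and $\tau_{j+1}$ lies to the right of $\gamma$, and $(\tau_j,k)\prec(\tau_{j+1},0)$ if it lies to the left. Let $m^{(k)}_{q/p}$ be the number of order ideals (downward closed subsets, including $\emptyset$) of $\mathcal{P}_{(p,q)}$. For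 sequences, $a_n\sim b_n$ means $\lim_{n\to\infty} a_n/b_n=1$. **Proposition 4.1.** Let $k\ge 0$ be an integer. (1) The sequence $f_n := m^{(k)}_{1/n}$, $n \ge 0$ (where the label $1/0$ stands for $(p,q)=(0,1)$), satisfies $f_0=1$, $f_1=k+2$ and, for all $n\ge 2$, $$f_n=(2k+3)f_{n-1}-f_{n-2}-k.$$ With $\alpha := 4k^2+12k+5$, for all $n \ge 0$, $$f_n=\frac{k}{1+2k}+\frac{2k^2+3k+1+(1+k)\sqrt{\alpha}}{2(1+2k)\sqrt{\alpha}}\left(\frac{3+2k+\sqrt{\alpha}}{2}\right)^n+\frac{-(2k^2+3k+1)+(1+k)\sqrt{\alpha}}{2(1+2k)\sqrt{\alpha}}\left(\frac{3+2k-\sqrt{\alpha}}{2}\right)^n,$$ and $$f_n\sim\frac{2k^2+3k+1+(1+k)\sqrt{\alpha}}{2(1+2k)\sqrt{\alpha}}\left(\frac{3+2k+\sqrt{\alpha}}{2}\right)^n.$$ (2) The sequence $g_n := m^{(k)}_{n/(n+1)}$, $n\ge 0$, satisfies $g_0=1$, $g_1=2k^2+6k+5$ and, for all $n\ge 2$,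 $$g_n=(3k^2+8k+6)g_{n-1}-g_{n-2}-k(k+2).$$ With $\beta := 3k^2+8k+6$ and $\delta := 3k^4+17k^3+34k^2+28k+8$, for all $n \ge 0$, $$g_n=\frac{k}{3k+2}+\frac{(k+1)(k+2)(\beta^2-4)+\delta\sqrt{\beta^2-4}}{(\beta-2)(\beta^2-4)}\left(\frac{\beta+\sqrt{\beta^2-4}}{2}\right)^n+\frac{(k+1)(k+2)(\beta^2-4)-\delta\sqrt{\beta^2-4}}{(\beta-2)(\beta^2-4)}\left(\frac{\beta-\sqrt{\beta^2-4}}{2}\right)^n,$$ and $$g_n\sim\frac{(k+1)(k+2)(\beta^2-4)+\delta\sqrt{\beta^2-4}}{(\beta-2)(\beta^2-4)}\left(\frac{\beta+\sqrt{\beta^2-4}}{2}\right)^n.$$ -/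

import Mathlib

open Filter Topology

namespace KMarkov

/-- The three directions (slopes `0`, `∞`, `-1`) of the lines of the lattice `𝓛`. -/
inductive Dir
  | horizontal
  | vertical
  | antidiagonal

/-- The vector from one integral point to the next one on a line of the given direction. -/
def Dir.vec : Dir → ℤ × ℤ
  | .horizontal => (1, 0)
  | .vertical => (0, 1)
  | .antidiagonal => (1, -1)

/-- A line segment of `𝓛`: it joins two consecutive integral points of a line of slope
`0`, `∞` or `-1` through integral points. Each such segment is represented exactly once. -/
structure LatticeSegment where
  /-- the first endpoint -/
  src : ℤ × ℤ
  /-- the direction -/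
  dir : Dir

/-- The second endpoint of a segment of `𝓛`. -/
def LatticeSegment.tgt (τ : LatticeSegment) : ℤ × ℤ := τ.src + τ.dir.vec

/-- `P` is one of the two endpoints of `τ`. -/
def LatticeSegment.IsEndpoint (τ : LatticeSegment) (P : ℤ × ℤ) : Prop :=
  P = τ.src ∨ P = τ.tgt

/-- The determinant of two vectors of `ℤ²`. -/
def det (u v : ℤ × ℤ) : ℤ := u.1 * v.2 - u.2 * v.1

/-- `P` lies to the right of the straight line from the origin to `(p, q)`. -/
def RightOf (p q : ℤ) (P : ℤ × ℤ) : Prop := det (p, q) P < 0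

/-- `P` lies to the left of the straight line from the origin to `(p, q)`. -/
def LeftOf (p q : ℤ) (P : ℤ × ℤ) : Prop := 0 < det (p, q) P

/-- A crossing of the oriented straight segment `γ` from `(0, 0)` to `(p, q)` with a line
segment of `𝓛`: the point `t • (p, q)` of `γ` is the point `src + s • (tgt - src)` of the
segment, it is interior to both, and the two are not parallel. The numbers `t` and `s` are
determined by the segment, so crossings correspond to the segments of `𝓛` crossed by `γ`. -/
structure Crossing (p q : ℤ) where
  /-- the segment of `𝓛` that is crossed -/
  seg : LatticeSegment
  /-- the position of the crossing along `γ` -/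
  t : ℝ
  /-- the position of the crossing along `seg` -/
  s : ℝ
  t_pos : 0 < t
  t_lt_one : t < 1
  s_pos : 0 < s
  s_lt_one : s < 1
  transversal : det (p, q) seg.dir.vec ≠ 0
  eq_fst : t * (p : ℝ) = (seg.src.1 : ℝ) + s * (seg.dir.vec.1 : ℝ)
  eq_snd : t * (q : ℝ) = (seg.src.2 : ℝ) + s * (seg.dir.vec.2 : ℝ)

/-- The crossing lies strictly closer to the endpoint of the crossed segment that lies to the
right of `γ` than to the other endpoint. -/
def Crossing.CloserToRight {p q : ℤ} (c : Crossing p q) : Prop :=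
  (RightOf p q c.seg.src ∧ c.s < 1 - c.s) ∨ (RightOf p q c.seg.tgt ∧ 1 - c.s < c.s)

/-- `γ` crosses `c` and then `c'`, with no crossing in between. -/
def Crossing.Consecutive {p q : ℤ} (c c' : Crossing p q) : Prop :=
  c.t < c'.t ∧ ∀ d : Crossing p q, ¬ (c.t < d.t ∧ d.t < c'.t)

/-- The elements `(τ, i)`, `0 ≤ i ≤ k`, of the fence poset of the straight segment `γ` from
`(0, 0)` to `(p, q)`, where `τ` is crossed by `γ`. -/
structure FencePoset (k : ℕ) (p q : ℤ) where
  /-- the crossing with `τ` -/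
  crossing : Crossing p q
  /-- the index in the chain of `τ` -/
  idx : Fin (k + 1)

/-- The relations `x ≺ y` that generate the order of the fence poset. -/
inductive FencePoset.Step {k : ℕ} {p q : ℤ} : FencePoset k p q → FencePoset k p q → Prop
  /-- `(τ, i) ≻ (τ, i + 1)` if the crossing is strictly closer to the right endpoint -/
  | chainDown (c : Crossing p q) (hc : c.CloserToRight) (i : Fin k) :
      Step ⟨c, i.succ⟩ ⟨c, i.castSucc⟩
  /-- `(τ, i) ≺ (τ, i + 1)` otherwise -/
  | chainUp (c : Crossing p q) (hc : ¬ c.CloserToRight) (i : Fin k) :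
      Step ⟨c, i.castSucc⟩ ⟨c, i.succ⟩
  /-- `(τ, k) ≻ (τ', 0)` if the common endpoint of `τ`, `τ'` lies to the right of `γ` -/
  | linkDown (c c' : Crossing p q) (h : c.Consecutive c') (P : ℤ × ℤ)
      (hP : c.seg.IsEndpoint P) (hP' : c'.seg.IsEndpoint P) (hr : RightOf p q P) :
      Step ⟨c', 0⟩ ⟨c, Fin.last k⟩
  /-- `(τ, k) ≺ (τ', 0)` if the common endpoint of `τ`, `τ'` lies to the left of `γ` -/
  | linkUp (c c' : Crossing p q) (h : c.Consecutive c') (P : ℤ × ℤ)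
      (hP : c.seg.IsEndpoint P) (hP' : c'.seg.IsEndpoint P) (hl : LeftOf p q P) :
      Step ⟨c, Fin.last k⟩ ⟨c', 0⟩

/-- The order of the fence poset: the reflexive transitive closure of the generating relations.
(Only the laws of a preorder are recorded; counting order ideals needs no more.) -/
instance (k : ℕ) (p q : ℤ) : Preorder (FencePoset k p q) where
  le := Relation.ReflTransGen FencePoset.Step
  le_refl _ := Relation.ReflTransGen.refl
  le_trans _ _ _ h h' := h.trans h'

end KMarkov

/-- For coprime `p`, `q`, the number `m^{(k)}_{q/p} = m^{(k)}_{(p,q)}`: the number of order ideals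
(downward closed subsets, including the empty one) of the fence poset of the straight segment
from `(0, 0)` to `(p, q)`. -/
noncomputable def kMarkovNumber (k : ℕ) (p q : ℤ) : ℕ :=
  Nat.card (LowerSet (KMarkov.FencePoset k p q))

/-!
The crossings of a segment in the first quadrant form a fence of chains, so its order ideals are
counted by a product of `2 × 2` transfer matrices, one for each generating relation; reversing a
relation transposes its matrix. The central symmetry of the segment reverses every relation outside
the middle chain, hence the product is palindromic up to transposition: if the row vector `(x, y)`
is the state after the first half of the fence, the number of ideals is `x² + y² + k x y`.

Along each of the two families the states satisfy a linear recursion that preserves a quadratic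
form, and the value of that form is the source of the constant term of the recurrence for the
numbers of ideals.
-/

namespace KMarkov

section TransferMatrix

open Matrix

variable {α R : Type*} [Fintype α] [DecidableEq α] [CommSemiring R]

lemma sum_prod_path (M : Matrix α α R) (k : ℕ) (u w : α → R) :
    ∑ A : Fin (k + 1) → α,
        u (A 0) * (∏ i : Fin k, M (A i.castSucc) (A i.succ)) * w (A (Fin.last k)) =
      u ⬝ᵥ M ^ k *ᵥ w := by
  induction k generalizing u with
  | zero =>
    rw [← (Equiv.funUnique (Fin 1) α).symm.sum_comp]
    simp [dotProduct]
  | succ k ih =>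
    rw [pow_succ', ← mulVec_mulVec, dotProduct_mulVec, ← ih, ← (Fin.consEquiv fun _ => α).sum_comp,
      Fintype.sum_prod_type, Finset.sum_comm]
    refine Finset.sum_congr rfl fun A _ => ?_
    simp only [Fin.consEquiv_apply, Fin.prod_univ_succ, Fin.castSucc_zero, Fin.cons_zero,
      Fin.cons_succ, ← Fin.succ_castSucc, ← Fin.succ_last, vecMul, dotProduct, Finset.sum_mul]
    exact Finset.sum_congr rfl fun a _ => by ring

/-- The product of the transfer matrices of the first `n` blocks of a path, where the `j`-th block
consists of `k` steps with transfer matrix `C j` followed by one step with transfer matrix `L j`. -/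
def blockProduct (k : ℕ) (C L : ℕ → Matrix α α R) : ℕ → Matrix α α R
  | 0 => 1
  | n + 1 => blockProduct k C L n * C n ^ k * L n

lemma sum_prod_blocks (k n : ℕ) (C L : ℕ → Matrix α α R) (w : α → R) :
    ∑ F : Fin (n + 1) → Fin (k + 1) → α,
        (∏ j : Fin (n + 1), ∏ i : Fin k, C j (F j i.castSucc) (F j i.succ)) *
          (∏ j : Fin n, L j (F j.castSucc (Fin.last k)) (F j.succ 0)) *
            w (F (Fin.last n) (Fin.last k)) =
      1 ⬝ᵥ (blockProduct k C L n * C n ^ k) *ᵥ w := by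
  induction n generalizing w with
  | zero =>
    rw [← (Equiv.funUnique (Fin 1) (Fin (k + 1) → α)).symm.sum_comp, blockProduct, one_mul,
      ← sum_prod_path]
    simp
  | succ n ih =>
    rw [blockProduct, mul_assoc, ← mulVec_mulVec, ← ih,
      ← (Fin.snocEquiv fun _ => Fin (k + 1) → α).sum_comp, Fintype.sum_prod_type, Finset.sum_comm]
    refine Finset.sum_congr rfl fun F _ => ?_
    rw [← mulVec_mulVec, mulVec, ← sum_prod_path, Finset.mul_sum]
    refine Finset.sum_congr rfl fun A _ => ?_
    simp only [Fin.snocEquiv_apply, Fin.prod_univ_castSucc, Fin.succ_castSucc, Fin.snoc_castSucc,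
      Fin.succ_last, Fin.snoc_last, Fin.val_castSucc, Fin.val_last]
    ring

lemma blockProduct_congr {k n : ℕ} {C C' L L' : ℕ → Matrix α α R} (hC : ∀ j < n, C j = C' j)
    (hL : ∀ j < n, L j = L' j) : blockProduct k C L n = blockProduct k C' L' n := by
  induction n with
  | zero => rfl
  | succ n ih =>
    rw [blockProduct, blockProduct, ih (fun j hj => hC j (by omega)) fun j hj => hL j (by omega),
      hC n (by omega), hL n (by omega)]

lemma blockProduct_mul_pow_of_symm {k c : ℕ} {C L : ℕ → Matrix α α R}
    (hC : ∀ r < c, C (2 * c - r) = (C r)ᵀ) (hL : ∀ r < c, L (2 * c - 1 - r) = (L r)ᵀ) :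
    blockProduct k C L (2 * c) * C (2 * c) ^ k =
      blockProduct k C L c * C c ^ k * (blockProduct k C L c)ᵀ := by
  suffices ∀ r ≤ c, blockProduct k C L (2 * c) * C (2 * c) ^ k =
      blockProduct k C L (2 * c - r) * C (2 * c - r) ^ k * (blockProduct k C L r)ᵀ by
    simpa only [two_mul, Nat.add_sub_cancel] using this c le_rfl
  intro r hr
  induction r with
  | zero => simp [blockProduct]
  | succ r ih =>
    have hpred : 2 * c - r = 2 * c - 1 - r + 1 := by omega
    rw [ih (by omega), hC r hr, hpred, blockProduct, blockProduct, hL r hr,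
      show 2 * c - (r + 1) = 2 * c - 1 - r by omega]
    simp only [transpose_mul, transpose_pow, mul_assoc]

end TransferMatrix

section FenceIdeals

open Matrix

/-- The condition that a set which contains `a` iff `x` and contains `b` iff `y` is downward closed
with respect to the single relation `a ≺ b` (if `up`) or `b ≺ a` (if not `up`). -/
abbrev Compatible (up x y : Prop) : Prop := (up → y → x) ∧ (¬ up → x → y)

/-- The transfer matrix that counts order ideals across one relation of a fence. -/
def transfer (up : Bool) : Matrix Bool Bool ℕ :=
  .of fun x y => if Compatible (up = true) (x = true) (y = true) then 1 else 0

lemma transfer_not (up : Bool) : transfer (!up) = (transfer up)ᵀ := by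
  revert up
  decide

lemma vecMul_transfer_true (v : Bool → ℕ) :
    v ᵥ* transfer true = fun b => cond b (v true) (v true + v false) := by
  ext b
  cases b <;> simp [vecMul, dotProduct, transfer, Compatible]

lemma vecMul_transfer_false (v : Bool → ℕ) :
    v ᵥ* transfer false = fun b => cond b (v true + v false) (v false) := by
  ext b
  cases b <;> simp [vecMul, dotProduct, transfer, Compatible]

lemma vecMul_transfer_true_pow (k : ℕ) (v : Bool → ℕ) :
    v ᵥ* transfer true ^ k = fun b => cond b (v true) (k * v true + v false) := by
  induction k with
  | zero => ext b; cases b <;> simp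
  | succ k ih =>
    rw [pow_succ, ← vecMul_vecMul, ih, vecMul_transfer_true]
    ext b
    cases b <;> simp only [cond_true, cond_false]
    ring

lemma vecMul_transfer_false_pow (k : ℕ) (v : Bool → ℕ) :
    v ᵥ* transfer false ^ k = fun b => cond b (v true + k * v false) (v false) := by
  induction k with
  | zero => ext b; cases b <;> simp
  | succ k ih =>
    rw [pow_succ, ← vecMul_vecMul, ih, vecMul_transfer_false]
    ext b
    cases b <;> simp only [cond_true, cond_false]
    ring

/-- The weights with which the two states of the last element enter the count of the order ideals
of the first `n` blocks of a fence, including the relation to the next block. -/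
def fenceState (k : ℕ) (chain link : ℕ → Bool) (n : ℕ) : Bool → ℕ :=
  1 ᵥ* blockProduct k (fun j => transfer (chain j)) (fun j => transfer (link j)) n

lemma fenceState_zero (k : ℕ) (chain link : ℕ → Bool) : fenceState k chain link 0 = 1 :=
  vecMul_one 1

lemma fenceState_succ (k : ℕ) (chain link : ℕ → Bool) (n : ℕ) :
    fenceState k chain link (n + 1) =
      fenceState k chain link n ᵥ* transfer (chain n) ^ k ᵥ* transfer (link n) := by
  simp only [fenceState, blockProduct, vecMul_vecMul, mul_assoc]

lemma fenceState_congr {k n : ℕ} {chain chain' link link' : ℕ → Bool}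
    (hchain : ∀ j < n, chain j = chain' j) (hlink : ∀ j < n, link j = link' j) :
    fenceState k chain link n = fenceState k chain' link' n := by
  rw [fenceState, blockProduct_congr (fun j hj => by rw [hchain j hj])
    fun j hj => by rw [hlink j hj], fenceState]

/-- The number of order ideals of a fence with an increasing middle chain whose two halves are
exchanged by an order-reversing symmetry, in terms of the state `v` of the first half. -/
def centralForm (k : ℕ) (v : Bool → ℕ) : ℕ :=
  v true ^ 2 + v false ^ 2 + k * (v true * v false)

lemma vecMul_transfer_true_pow_dotProduct (k : ℕ) (v : Bool → ℕ) :
    (v ᵥ* transfer true ^ k) ⬝ᵥ v = centralForm k v := by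
  simp only [vecMul_transfer_true_pow, dotProduct, Fintype.sum_bool, centralForm, cond_true,
    cond_false]
  ring

theorem fence_eq_centralForm_of_symm (k : ℕ) {c : ℕ} {chain link : ℕ → Bool}
    (hchain : ∀ r < c, chain (2 * c - r) = !chain r)
    (hlink : ∀ r < c, link (2 * c - 1 - r) = !link r) (hmid : chain c = true) :
    1 ⬝ᵥ (blockProduct k (fun j => transfer (chain j)) (fun j => transfer (link j)) (2 * c) *
        transfer (chain (2 * c)) ^ k) *ᵥ 1 =
      centralForm k (fenceState k chain link c) := by
  rw [blockProduct_mul_pow_of_symm (fun r hr => by rw [hchain r hr, transfer_not])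
      (fun r hr => by rw [hlink r hr, transfer_not]), hmid, ← mulVec_mulVec, mulVec_transpose,
    dotProduct_mulVec, ← vecMul_vecMul]
  exact vecMul_transfer_true_pow_dotProduct k _

variable {k n : ℕ} {p q : ℤ}

lemma not_leftOf_of_rightOf {P : ℤ × ℤ} (h : RightOf p q P) : ¬ LeftOf p q P := lt_asymm h

lemma FencePoset.isLowerSet_iff_step {S : Set (FencePoset k p q)} :
    IsLowerSet S ↔ ∀ ⦃x y⦄, FencePoset.Step x y → y ∈ S → x ∈ S := by
  refine ⟨fun h x y hxy hy => h (Relation.ReflTransGen.single hxy) hy, fun h y x hxy hy => ?_⟩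
  change Relation.ReflTransGen FencePoset.Step x y at hxy
  induction hxy using Relation.ReflTransGen.head_induction_on with
  | refl => exact hy
  | head hstep _ ih => exact h hstep ih

theorem FencePoset.isLowerSet_iff_compatible
    (hside : ∀ (c : Crossing p q) P, c.seg.IsEndpoint P → LeftOf p q P ∨ RightOf p q P)
    {S : Set (FencePoset k p q)} :
    IsLowerSet S ↔
      (∀ (c : Crossing p q) (i : Fin k),
        Compatible (¬ c.CloserToRight) (⟨c, i.castSucc⟩ ∈ S) (⟨c, i.succ⟩ ∈ S)) ∧
      ∀ c c' : Crossing p q, c.Consecutive c' →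
        ∀ P, c.seg.IsEndpoint P → c'.seg.IsEndpoint P →
          Compatible (LeftOf p q P) (⟨c, Fin.last k⟩ ∈ S) (⟨c', 0⟩ ∈ S) := by
  rw [isLowerSet_iff_step]
  refine ⟨fun h => ⟨fun c i => ⟨fun hc => h (.chainUp c hc i), fun hc => h (.chainDown c
    (not_not.1 hc) i)⟩, fun c c' hcc P hP hP' => ⟨fun hl => h (.linkUp c c' hcc P hP hP' hl),
    fun hl => h (.linkDown c c' hcc P hP hP' ((hside c P hP).resolve_left hl))⟩⟩, ?_⟩
  rintro ⟨hchain, hlink⟩ x y (⟨c, hc, i⟩ | ⟨c, hc, i⟩ | ⟨c, c', hcc, P, hP, hP', hr⟩ |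
    ⟨c, c', hcc, P, hP, hP', hl⟩)
  · exact (hchain c i).2 (not_not.2 hc)
  · exact (hchain c i).1 hc
  · exact (hlink c c' hcc P hP hP').2 (not_leftOf_of_rightOf hr)
  · exact (hlink c c' hcc P hP hP').1 hl

lemma Crossing.consecutive_iff {e : Fin (n + 1) ≃ Crossing p q} (he : StrictMono fun j => (e j).t)
    {i j : Fin (n + 1)} : (e i).Consecutive (e j) ↔ (i : ℕ) + 1 = j := by
  have hforall : (∀ d : Crossing p q, ¬ ((e i).t < d.t ∧ d.t < (e j).t)) ↔
      ∀ l, ¬ (i < l ∧ l < j) := by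
    rw [e.surjective.forall]
    exact forall_congr' fun l => not_congr (and_congr he.lt_iff_lt he.lt_iff_lt)
  rw [Crossing.Consecutive, he.lt_iff_lt, hforall]
  refine ⟨fun ⟨hij, h⟩ => ?_, fun h => ⟨Fin.lt_def.2 (by omega), fun l hl => by omega⟩⟩
  exact (Nat.succ_le_of_lt hij).eq_or_lt.resolve_right fun hlt =>
    h ⟨i + 1, by omega⟩ ⟨Fin.lt_def.2 (by simp), hlt⟩

section Enumeration

variable {e : Fin (n + 1) ≃ Crossing p q} {P : ℕ → ℤ × ℤ} {chain link : ℕ → Bool}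

lemma FencePoset.isLowerSet_iff_of_enumeration
    (hside : ∀ (c : Crossing p q) Q, c.seg.IsEndpoint Q → LeftOf p q Q ∨ RightOf p q Q)
    (he : StrictMono fun j => (e j).t)
    (hpivot : ∀ (j : Fin n) Q,
      (e j.castSucc).seg.IsEndpoint Q ∧ (e j.succ).seg.IsEndpoint Q ↔ Q = P j)
    (hchain : ∀ j, ¬ (e j).CloserToRight ↔ chain j = true)
    (hlink : ∀ j : Fin n, LeftOf p q (P j) ↔ link j = true) {S : Set (FencePoset k p q)} :
    IsLowerSet S ↔
      (∀ (j : Fin (n + 1)) (i : Fin k),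
        Compatible (chain j = true) (⟨e j, i.castSucc⟩ ∈ S) (⟨e j, i.succ⟩ ∈ S)) ∧
      ∀ j : Fin n,
        Compatible (link j = true) (⟨e j.castSucc, Fin.last k⟩ ∈ S) (⟨e j.succ, 0⟩ ∈ S) := by
  rw [isLowerSet_iff_compatible hside]
  refine and_congr (e.forall_congr_right.symm.trans ?_) ⟨fun h j => ?_, fun h => ?_⟩
  · exact forall_congr' fun j => by rw [hchain]
  · obtain ⟨hP, hP'⟩ := (hpivot j (P j)).2 rfl
    rw [← hlink]
    exact h _ _ ((Crossing.consecutive_iff he).2 (by simp)) _ hP hP'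
  · refine e.forall_congr_right.1 fun i => e.forall_congr_right.1 fun i' hcons Q hQ hQ' => ?_
    rw [Crossing.consecutive_iff he] at hcons
    obtain ⟨j, rfl, rfl⟩ : ∃ j : Fin n, i = j.castSucc ∧ i' = j.succ :=
      ⟨⟨i, by omega⟩, Fin.ext rfl, Fin.ext hcons.symm⟩
    rw [(hpivot j Q).1 ⟨hQ, hQ'⟩, hlink]
    exact h j

theorem card_lowerSet_fencePoset
    (hside : ∀ (c : Crossing p q) Q, c.seg.IsEndpoint Q → LeftOf p q Q ∨ RightOf p q Q)
    (he : StrictMono fun j => (e j).t)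
    (hpivot : ∀ (j : Fin n) Q,
      (e j.castSucc).seg.IsEndpoint Q ∧ (e j.succ).seg.IsEndpoint Q ↔ Q = P j)
    (hchain : ∀ j, ¬ (e j).CloserToRight ↔ chain j = true)
    (hlink : ∀ j : Fin n, LeftOf p q (P j) ↔ link j = true) :
    Nat.card (LowerSet (FencePoset k p q)) =
      1 ⬝ᵥ (blockProduct k (fun j => transfer (chain j)) (fun j => transfer (link j)) n *
        transfer (chain n) ^ k) *ᵥ 1 := by
  classical
  have hlower (S : Set (FencePoset k p q)) :=
    FencePoset.isLowerSet_iff_of_enumeration hside he hpivot hchain hlink (S := S)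
  let ideals : LowerSet (FencePoset k p q) ≃ {F : Fin (n + 1) → Fin (k + 1) → Bool //
      (∀ (j : Fin (n + 1)) (i : Fin k),
        Compatible (chain j = true) (F j i.castSucc = true) (F j i.succ = true)) ∧
      ∀ j : Fin n, Compatible (link j = true) (F j.castSucc (Fin.last k) = true)
        (F j.succ 0 = true)} :=
    { toFun S := ⟨fun j i => decide (⟨e j, i⟩ ∈ S),
        by simpa only [decide_eq_true_eq, SetLike.mem_coe] using (hlower S).1 S.lower⟩
      invFun F := ⟨{x | F.1 (e.symm x.crossing) x.idx = true},
        (hlower _).2 (by simpa only [Set.mem_ofPred_eq, Equiv.symm_apply_apply] using F.2)⟩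
      left_inv S := by ext; simp
      right_inv F := by ext; simp }
  rw [Nat.card_congr ideals, Nat.card_eq_fintype_card, Fintype.card_subtype, Finset.card_filter,
    ← sum_prod_blocks]
  refine Finset.sum_congr rfl fun F _ => ?_
  simp only [transfer, of_apply, Finset.prod_boole, Finset.mem_univ, true_implies, Pi.one_apply,
    ite_zero_mul_ite_zero, mul_one]

end Enumeration

end FenceIdeals

section Geometry

open Matrix

variable {p q : ℤ}

/-- The coordinate that is constant on the lines of the given direction. It numbers these lines, so
a segment of `𝓛` lies on the line with number `dir.level src`. -/
def Dir.level : Dir → ℤ × ℤ → ℤ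
  | .horizontal, P => P.2
  | .vertical, P => P.1
  | .antidiagonal, P => P.1 + P.2

lemma Dir.level_add_vec (d : Dir) (P : ℤ × ℤ) : d.level (P + d.vec) = d.level P := by
  cases d <;> simp only [Dir.level, Dir.vec, Prod.fst_add, Prod.snd_add] <;> ring

lemma Dir.level_ne_zero {d : Dir} (h : det (p, q) d.vec ≠ 0) : d.level (p, q) ≠ 0 := by
  cases d <;> simp only [det, Dir.vec, Dir.level] at h ⊢ <;> omega

lemma Dir.ext_of_level {d d' : Dir} (hne : d ≠ d') {P Q : ℤ × ℤ} (h : d.level P = d.level Q)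
    (h' : d'.level P = d'.level Q) : P = Q := by
  cases d <;> cases d' <;> simp only [Dir.level, ne_eq, not_true_eq_false] at hne h h' <;>
    exact Prod.ext (by omega) (by omega)

lemma LatticeSegment.IsEndpoint.level_eq {τ : LatticeSegment} {P : ℤ × ℤ} (h : τ.IsEndpoint P) :
    τ.dir.level P = τ.dir.level τ.src := by
  rcases h with rfl | rfl
  · rfl
  · exact τ.dir.level_add_vec _

lemma LatticeSegment.IsEndpoint.unique {τ τ' : LatticeSegment} (hdir : τ.dir ≠ τ'.dir)
    {P Q : ℤ × ℤ} (hP : τ.IsEndpoint P) (hP' : τ'.IsEndpoint P) (hQ : τ.IsEndpoint Q)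
    (hQ' : τ'.IsEndpoint Q) : P = Q :=
  Dir.ext_of_level hdir (hP.level_eq.trans hQ.level_eq.symm) (hP'.level_eq.trans hQ'.level_eq.symm)

lemma det_add (u v w : ℤ × ℤ) : det u (v + w) = det u v + det u w := by
  simp only [det, Prod.fst_add, Prod.snd_add]
  ring

lemma leftOf_iff_rightOf_of_add_eq {P Q : ℤ × ℤ} {l : ℤ} (h : P + Q = (l * p, l * q)) :
    LeftOf p q P ↔ RightOf p q Q := by
  have : det (p, q) P + det (p, q) Q = 0 := by
    rw [← det_add, h, det]
    ring
  rw [LeftOf, RightOf]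
  omega

namespace Crossing

lemma t_mul_level (c : Crossing p q) :
    c.t * (c.seg.dir.level (p, q) : ℝ) = (c.seg.dir.level c.seg.src : ℝ) := by
  have h₁ := c.eq_fst
  have h₂ := c.eq_snd
  cases hd : c.seg.dir <;> simp only [hd, Dir.vec, Dir.level] at h₁ h₂ ⊢ <;>
    push_cast at h₁ h₂ ⊢ <;> linarith

lemma det_src (c : Crossing p q) :
    (det (p, q) c.seg.src : ℝ) = -(c.s * (det (p, q) c.seg.dir.vec : ℝ)) := by
  simp only [det]
  push_cast
  linear_combination (q : ℝ) * c.eq_fst - (p : ℝ) * c.eq_snd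

lemma det_tgt (c : Crossing p q) :
    (det (p, q) c.seg.tgt : ℝ) = (1 - c.s) * (det (p, q) c.seg.dir.vec : ℝ) := by
  rw [LatticeSegment.tgt, det_add, Int.cast_add, det_src]
  ring

lemma leftOf_or_rightOf (c : Crossing p q) {P : ℤ × ℤ} (hP : c.seg.IsEndpoint P) :
    LeftOf p q P ∨ RightOf p q P := by
  have hdet : (det (p, q) c.seg.dir.vec : ℝ) ≠ 0 := Int.cast_ne_zero.2 c.transversal
  refine (lt_or_gt_of_ne (Int.cast_ne_zero (α := ℝ).1 ?_)).symm
  rcases hP with rfl | rfl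
  · exact c.det_src ▸ neg_ne_zero.2 (mul_ne_zero c.s_pos.ne' hdet)
  · exact c.det_tgt ▸ mul_ne_zero (sub_pos.2 c.s_lt_one).ne' hdet

lemma closerToRight_iff (c : Crossing p q) :
    c.CloserToRight ↔ LeftOf p q (c.seg.src + c.seg.tgt) := by
  have hs : 0 < 1 - c.s := sub_pos.2 c.s_lt_one
  have hmid : (det (p, q) (c.seg.src + c.seg.tgt) : ℝ) =
      (1 - 2 * c.s) * (det (p, q) c.seg.dir.vec : ℝ) := by
    rw [det_add, Int.cast_add, det_src, det_tgt]
    ring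
  rw [CloserToRight, LeftOf, RightOf, RightOf, ← Int.cast_pos (R := ℝ), hmid,
    ← Int.cast_lt_zero (R := ℝ), ← Int.cast_lt_zero (R := ℝ), det_src, det_tgt, neg_lt_zero,
    mul_pos_iff_of_pos_left c.s_pos, mul_pos_iff, mul_neg_iff]
  constructor
  · rintro (⟨hD, h⟩ | ⟨hD | hD, h⟩)
    · exact .inl ⟨by linarith, hD⟩
    · exact .inr ⟨by linarith, hD.2⟩
    · exact absurd hD.1 hs.not_gt
  · rintro (⟨h, hD⟩ | ⟨h, hD⟩)
    · exact .inl ⟨hD, by linarith⟩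
    · exact .inr ⟨.inl ⟨hs, hD⟩, by linarith⟩

lemma level_src_pos_and_lt (hp : 0 ≤ p) (hq : 0 ≤ q) (c : Crossing p q) :
    0 < c.seg.dir.level c.seg.src ∧ c.seg.dir.level c.seg.src < c.seg.dir.level (p, q) := by
  have hlevel : (0 : ℝ) < c.seg.dir.level (p, q) := by
    refine Int.cast_pos.2 (lt_of_le_of_ne ?_ (Dir.level_ne_zero c.transversal).symm)
    cases c.seg.dir <;> simp only [Dir.level] <;> omega
  rw [← Int.cast_pos (R := ℝ), ← Int.cast_lt (R := ℝ), ← t_mul_level]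
  exact ⟨mul_pos c.t_pos hlevel, mul_lt_of_lt_one_left hlevel c.t_lt_one⟩

lemma ext_of_seg {c c' : Crossing p q} (h : c.seg = c'.seg) (ht : c.t = c'.t) : c = c' := by
  have hs : c.s = c'.s := by
    refine mul_right_cancel₀ (Int.cast_ne_zero (α := ℝ).2 c.transversal) (neg_injective ?_)
    rw [← det_src, h, det_src]
  cases c
  cases c'
  simp only [mk.injEq] at h ht hs ⊢
  exact ⟨h, ht, hs⟩

lemma eq_of_level_eq {c c' : Crossing p q} (hdir : c.seg.dir = c'.seg.dir)
    (hlevel : c.seg.dir.level c.seg.src = c.seg.dir.level c'.seg.src) : c = c' := by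
  have ht : c.t = c'.t := by
    refine mul_right_cancel₀ (Int.cast_ne_zero (α := ℝ).2 (Dir.level_ne_zero c.transversal)) ?_
    rw [t_mul_level, hlevel, hdir, t_mul_level]
  have hfloor (d : Crossing p q) (a : ℤ) : ⌊(a : ℝ) + d.s⌋ = a := by
    rw [Int.floor_intCast_add, Int.floor_eq_zero_iff.2 ⟨d.s_pos.le, d.s_lt_one⟩, add_zero]
  have hround {a b : ℤ} (h : (a : ℝ) + c.s = b + c'.s) : a = b := by
    rw [← hfloor c a, h, hfloor]
  have hfst := c.eq_fst.symm.trans (ht ▸ c'.eq_fst)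
  have hsnd := c.eq_snd.symm.trans (ht ▸ c'.eq_snd)
  suffices hsrc : c.seg.src = c'.seg.src from ext_of_seg (congrArg₂ LatticeSegment.mk hsrc hdir) ht
  rw [← hdir] at hfst hsnd
  cases hd : c.seg.dir <;>
    simp only [hd, Dir.vec, Dir.level, Int.cast_one, mul_one] at hfst hsnd hlevel
  · exact Prod.ext (hround hfst) hlevel
  · exact Prod.ext hlevel (hround hsnd)
  · have := hround hfst
    exact Prod.ext this (by omega)

end Crossing

/-- The arithmetic criterion for `τ` to be crossed by `γ`, in the first quadrant: the line of `τ`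
separates the ends of `γ`, and the line of `γ` separates the ends of `τ`. -/
def LatticeSegment.IsCrossed (p q : ℤ) (τ : LatticeSegment) : Prop :=
  (0 < τ.dir.level τ.src ∧ τ.dir.level τ.src < τ.dir.level (p, q)) ∧
    (LeftOf p q τ.src ∧ RightOf p q τ.tgt ∨ RightOf p q τ.src ∧ LeftOf p q τ.tgt)

lemma LatticeSegment.IsCrossed.exists_crossing {τ : LatticeSegment} (h : τ.IsCrossed p q) :
    ∃ c : Crossing p q, c.seg = τ := by
  obtain ⟨⟨hpos, hlt⟩, hsides⟩ := h
  rw [LeftOf, RightOf, LeftOf, RightOf, LatticeSegment.tgt, det_add] at hsides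
  set a := det (p, q) τ.src with ha
  set D := det (p, q) τ.dir.vec with hD
  have hlevel : (0 : ℝ) < τ.dir.level (p, q) := Int.cast_pos.2 (hpos.trans hlt)
  have hD₀ : D ≠ 0 := by omega
  have hs : (0 : ℝ) < -a / D ∧ (-a / D : ℝ) < 1 := by
    rcases hsides with ⟨ha, hb⟩ | ⟨ha, hb⟩ <;> rify at ha hb
    · exact ⟨div_pos_of_neg_of_neg (by linarith) (by linarith),
        (div_lt_one_of_neg (by linarith)).2 (by linarith)⟩
    · exact ⟨div_pos (by linarith) (by linarith), (div_lt_one (by linarith)).2 (by linarith)⟩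
  have hD' : (D : ℝ) ≠ 0 := Int.cast_ne_zero.2 hD₀
  refine ⟨⟨τ, τ.dir.level τ.src / τ.dir.level (p, q), -a / D, div_pos (Int.cast_pos.2 hpos) hlevel,
    (div_lt_one hlevel).2 (Int.cast_lt.2 hlt), hs.1, hs.2, hD₀, ?_, ?_⟩, rfl⟩
  all_goals
    field_simp
    norm_cast
    rw [ha, hD]
    cases τ.dir <;> simp only [det, Dir.vec, Dir.level] <;> ring

lemma isEmpty_crossing (hp : 0 ≤ p) (hq : 0 ≤ q) (h : p + q ≤ 1) : IsEmpty (Crossing p q) := by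
  refine ⟨fun c => ?_⟩
  have := c.level_src_pos_and_lt hp hq
  cases hd : c.seg.dir <;> simp only [hd, Dir.level] at this <;> omega

theorem kMarkovNumber_of_add_le_one (k : ℕ) (hp : 0 ≤ p) (hq : 0 ≤ q) (h : p + q ≤ 1) :
    kMarkovNumber k p q = 1 := by
  have : IsEmpty (FencePoset k p q) := ⟨fun x => (isEmpty_crossing hp hq h).false x.crossing⟩
  rw [kMarkovNumber, Nat.card_eq_one_iff_unique]
  exact ⟨⟨fun S T => SetLike.ext fun x => this.elim x⟩, ⟨⊥⟩⟩

/-- `σ 0, …, σ n` are the segments of `𝓛` crossed by the segment `γ` from the origin to `(p, q)`, in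
the order in which they are crossed, and `P j` is the common endpoint of `σ j` and `σ (j + 1)`.
By `complete`, `γ` crosses some `σ j` on every line that it meets between its ends; by `level_lt`,
the position `level (σ j).src / level (p, q)` of the crossings along `γ` increases with `j`. -/
structure IsCrossingSequence (p q : ℤ) (n : ℕ) (σ : ℕ → LatticeSegment) (P : ℕ → ℤ × ℤ) :
    Prop where
  isCrossed : ∀ j ≤ n, (σ j).IsCrossed p q
  complete : ∀ (d : Dir) (l : ℤ), 0 < l → l < d.level (p, q) →
    ∃ j ≤ n, (σ j).dir = d ∧ d.level (σ j).src = l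
  level_lt : ∀ j < n, (σ j).dir.level (σ j).src * (σ (j + 1)).dir.level (p, q) <
    (σ (j + 1)).dir.level (σ (j + 1)).src * (σ j).dir.level (p, q)
  dir_ne : ∀ j < n, (σ j).dir ≠ (σ (j + 1)).dir
  isEndpoint : ∀ j < n, (σ j).IsEndpoint (P j) ∧ (σ (j + 1)).IsEndpoint (P j)

namespace IsCrossingSequence

variable {n : ℕ} {σ : ℕ → LatticeSegment} {P : ℕ → ℤ × ℤ}

lemma exists_enumeration (h : IsCrossingSequence p q n σ P) (hp : 0 ≤ p) (hq : 0 ≤ q) :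
    ∃ e : Fin (n + 1) ≃ Crossing p q, StrictMono (fun j => (e j).t) ∧ ∀ j, (e j).seg = σ j := by
  choose c hc using fun j : Fin (n + 1) => (h.isCrossed j (by omega)).exists_crossing
  have hmono : StrictMono fun j => (c j).t := by
    refine Fin.strictMono_iff_lt_succ.2 fun j => ?_
    have hpos (i : Fin (n + 1)) : (0 : ℝ) < (σ i).dir.level (p, q) := by
      obtain ⟨h₁, h₂⟩ := (h.isCrossed i (by omega)).1
      exact Int.cast_pos.2 (h₁.trans h₂)
    have ht (i : Fin (n + 1)) :
        (c i).t = (σ i).dir.level (σ i).src / (σ i).dir.level (p, q) := by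
      rw [eq_div_iff (hpos i).ne', ← hc i, Crossing.t_mul_level]
    rw [ht, ht, div_lt_div_iff₀ (hpos _) (hpos _)]
    exact_mod_cast h.level_lt j j.2
  have hsurj : Function.Surjective c := fun d => by
    obtain ⟨hpos, hlt⟩ := d.level_src_pos_and_lt hp hq
    obtain ⟨j, hj, hdir, hlevel⟩ := h.complete _ _ hpos hlt
    refine ⟨⟨j, by omega⟩, Crossing.eq_of_level_eq (by rw [hc, hdir]) ?_⟩
    rw [hc, hdir, hlevel]
  have hinj : Function.Injective c := fun i j hij => hmono.injective (congrArg Crossing.t hij)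
  exact ⟨.ofBijective c ⟨hinj, hsurj⟩, hmono, hc⟩

theorem kMarkovNumber_eq (h : IsCrossingSequence p q n σ P) (hp : 0 ≤ p) (hq : 0 ≤ q) (k : ℕ)
    {chain link : ℕ → Bool}
    (hchain : ∀ j ≤ n, ¬ LeftOf p q ((σ j).src + (σ j).tgt) ↔ chain j = true)
    (hlink : ∀ j < n, LeftOf p q (P j) ↔ link j = true) :
    kMarkovNumber k p q =
      1 ⬝ᵥ (blockProduct k (fun j => transfer (chain j)) (fun j => transfer (link j)) n *
        transfer (chain n) ^ k) *ᵥ 1 := by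
  obtain ⟨e, hmono, he⟩ := h.exists_enumeration hp hq
  refine card_lowerSet_fencePoset (fun c Q => c.leftOf_or_rightOf) hmono (fun j Q => ?_)
    (fun j => ?_) fun j => hlink j j.2
  · obtain ⟨hP, hP'⟩ := h.isEndpoint j j.2
    rw [he, he]
    refine ⟨fun ⟨hQ, hQ'⟩ => hQ.unique (h.dir_ne j j.2) hQ' hP hP', ?_⟩
    rintro rfl
    exact ⟨hP, hP'⟩
  · rw [Crossing.closerToRight_iff, he, hchain j (by omega)]

theorem kMarkovNumber_eq_centralForm {c : ℕ} (h : IsCrossingSequence p q (2 * c) σ P) (hp : 0 ≤ p)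
    (hq : 0 ≤ q) (k : ℕ) {chain link : ℕ → Bool}
    (hmid : ∀ r ≤ c, (σ (2 * c - r)).src + (σ (2 * c - r)).tgt + ((σ r).src + (σ r).tgt) =
      (2 * p, 2 * q))
    (hpivot : ∀ r < c, P (2 * c - 1 - r) + P r = (p, q))
    (hchain : ∀ r < c, bif chain r then RightOf p q ((σ r).src + (σ r).tgt)
      else LeftOf p q ((σ r).src + (σ r).tgt))
    (hlink : ∀ r < c, LeftOf p q (P r) ↔ link r = true) :
    kMarkovNumber k p q = centralForm k (fenceState k chain link c) := by
  classical
  let chain' j := decide ¬ LeftOf p q ((σ j).src + (σ j).tgt)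
  let link' j := decide (LeftOf p q (P j))
  have hchain' (r) (hr : r < c) : chain' r = chain r := by
    have := hchain r hr
    cases hb : chain r <;> simp only [hb, cond_true, cond_false] at this
    · exact decide_eq_false (not_not.2 this)
    · exact decide_eq_true (not_leftOf_of_rightOf this)
  have hchain_symm (r) (hr : r < c) : chain' (2 * c - r) = !chain' r := by
    have := hchain r hr
    rw [hchain' r hr]
    simp only [chain', leftOf_iff_rightOf_of_add_eq (hmid r hr.le)]
    cases hb : chain r <;> simp only [hb, cond_true, cond_false] at this
    · exact decide_eq_true fun hr => not_leftOf_of_rightOf hr this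
    · exact decide_eq_false (not_not.2 this)
  have hchain_mid : chain' c = true := by
    have := leftOf_iff_rightOf_of_add_eq (hmid c le_rfl)
    rw [show 2 * c - c = c by omega] at this
    exact decide_eq_true fun hl => not_leftOf_of_rightOf (this.1 hl) hl
  have hlink' (r) (hr : r < c) : link' r = link r :=
    Bool.eq_iff_iff.2 (decide_eq_true_iff.trans (hlink r hr))
  have hlink_symm (r) (hr : r < c) : link' (2 * c - 1 - r) = !link' r := by
    obtain ⟨d, hd⟩ := (h.isCrossed r (by omega)).exists_crossing
    have hside := d.leftOf_or_rightOf (hd ▸ (h.isEndpoint r (by omega)).1)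
    have hrefl := leftOf_iff_rightOf_of_add_eq (l := 1)
      (by simpa only [one_mul] using hpivot r hr)
    rw [← decide_not]
    exact decide_eq_decide.2 (hrefl.trans ⟨not_leftOf_of_rightOf, hside.resolve_left⟩)
  rw [h.kMarkovNumber_eq hp hq k (fun j _ => decide_eq_true_iff.symm)
    (fun j _ => decide_eq_true_iff.symm), ← fenceState_congr hchain' hlink']
  exact fence_eq_centralForm_of_symm k hchain_symm hlink_symm hchain_mid

end IsCrossingSequence

end Geometry

section UnitSlope

/-- The segments crossed by the segment from the origin to `(c + 1, 1)`. -/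
def unitSegment (j : ℕ) : LatticeSegment :=
  if j % 2 = 0 then ⟨(j / 2, 1), .antidiagonal⟩ else ⟨(j / 2 + 1, 0), .vertical⟩

/-- The common endpoint of `unitSegment j` and `unitSegment (j + 1)`. -/
def unitPivot (j : ℕ) : ℤ × ℤ := (j / 2 + 1, j % 2)

lemma unitSegment_two_mul (a : ℕ) : unitSegment (2 * a) = ⟨(a, 1), .antidiagonal⟩ := by
  simp [unitSegment]

lemma unitSegment_two_mul_add_one (a : ℕ) :
    unitSegment (2 * a + 1) = ⟨(a + 1, 0), .vertical⟩ := by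
  have : (2 * (a : ℤ) + 1) / 2 = a := by omega
  simp [unitSegment, Nat.add_mod, this]

lemma unitSegment_src_add_tgt (j : ℕ) :
    (unitSegment j).src + (unitSegment j).tgt = ((j : ℤ) + 1, 1) := by
  obtain ⟨a, rfl | rfl⟩ := j.even_or_odd' <;>
    simp only [unitSegment_two_mul, unitSegment_two_mul_add_one, LatticeSegment.tgt, Dir.vec,
      Prod.mk_add_mk, Prod.mk.injEq] <;>
    omega

lemma isCrossingSequence_unitSegment (c : ℕ) :
    IsCrossingSequence (c + 1) 1 (2 * c) unitSegment unitPivot where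
  isCrossed j hj := by
    obtain ⟨a, rfl | rfl⟩ := j.even_or_odd' <;>
      simp only [unitSegment_two_mul, unitSegment_two_mul_add_one, LatticeSegment.IsCrossed, LeftOf,
        RightOf, LatticeSegment.tgt, Dir.level, Dir.vec, det, Prod.mk_add_mk] <;>
      omega
  complete d l hl hlt := by
    cases d <;> simp only [Dir.level] at hlt
    · omega
    · refine ⟨2 * (l.toNat - 1) + 1, by omega, ?_⟩
      simp only [unitSegment_two_mul_add_one, Dir.level, true_and]
      omega
    · refine ⟨2 * (l.toNat - 1), by omega, ?_⟩
      simp only [unitSegment_two_mul, Dir.level, true_and]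
      omega
  level_lt j hj := by
    obtain ⟨a, rfl | rfl⟩ := j.even_or_odd'
    · simp only [unitSegment_two_mul, unitSegment_two_mul_add_one, Dir.level]
      nlinarith
    · simp only [unitSegment_two_mul, unitSegment_two_mul_add_one, Dir.level,
        show 2 * a + 1 + 1 = 2 * (a + 1) by ring]
      push_cast
      nlinarith
  dir_ne j hj := by
    obtain ⟨a, rfl | rfl⟩ := j.even_or_odd' <;>
      simp [unitSegment_two_mul, unitSegment_two_mul_add_one,
        show 2 * a + 1 + 1 = 2 * (a + 1) by ring]
  isEndpoint j hj := by
    obtain ⟨a, rfl | rfl⟩ := j.even_or_odd' <;>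
      simp only [unitPivot, unitSegment_two_mul, unitSegment_two_mul_add_one,
        show 2 * a + 1 + 1 = 2 * (a + 1) by ring, LatticeSegment.IsEndpoint, LatticeSegment.tgt,
        Dir.vec, Prod.mk_add_mk, Prod.mk.injEq] <;>
      omega

/-- The state of the first `n` blocks of the fence of `(c + 1, 1)`, for `n ≤ c`. -/
abbrev unitState (k n : ℕ) : Bool → ℕ :=
  fenceState k (fun _ => false) (fun j => decide (j % 2 = 1)) n

theorem kMarkovNumber_unit (k c : ℕ) :
    kMarkovNumber k (c + 1) 1 = centralForm k (unitState k c) := by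
  refine (isCrossingSequence_unitSegment c).kMarkovNumber_eq_centralForm (by omega) (by omega) k
    (fun r hr => ?_) (fun r hr => ?_) (fun r hr => ?_) fun r hr => ?_
  · simp only [unitSegment_src_add_tgt, Prod.mk_add_mk, Prod.mk.injEq]
    omega
  · simp only [unitPivot, Prod.mk_add_mk, Prod.mk.injEq]
    omega
  · simp only [unitSegment_src_add_tgt, LeftOf, det, cond_false]
    omega
  · simp only [LeftOf, det, unitPivot, decide_eq_true_eq]
    obtain h | h := Nat.mod_two_eq_zero_or_one r
    · have : (r : ℤ) % 2 = 0 := by omega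
      simp only [this, h]
      omega
    · have : (r : ℤ) % 2 = 1 := by omega
      simp only [this, h, iff_true]
      omega

lemma unitState_two_mul_add_one (k a : ℕ) :
    unitState k (2 * a + 1) = fun b =>
      cond b (unitState k (2 * a) true + (k + 1) * unitState k (2 * a) false)
        (unitState k (2 * a) false) := by
  rw [unitState, fenceState_succ, show decide (2 * a % 2 = 1) = false by simp,
    vecMul_transfer_false_pow, vecMul_transfer_false]
  ext b
  cases b <;> simp only [cond_true, cond_false]
  ring

lemma unitState_two_mul_add_two (k a : ℕ) :
    unitState k (2 * a + 2) = fun b =>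
      cond b (unitState k (2 * a + 1) true + k * unitState k (2 * a + 1) false)
        (unitState k (2 * a + 1) true + (k + 1) * unitState k (2 * a + 1) false) := by
  rw [unitState, fenceState_succ, show decide ((2 * a + 1) % 2 = 1) = true by simp,
    vecMul_transfer_false_pow, vecMul_transfer_true]
  ext b
  cases b <;> simp only [cond_true, cond_false]
  ring

lemma unitState_invariant (k a : ℕ) :
    unitState k (2 * a) true ^ 2 +
        (2 * k + 1) * unitState k (2 * a) true * unitState k (2 * a) false =
      (2 * k + 1) * unitState k (2 * a) false ^ 2 + 1 := by
  induction a with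
  | zero =>
    simp only [mul_zero, unitState, fenceState_zero, Pi.one_apply]
    ring
  | succ a ih =>
    rw [show 2 * (a + 1) = 2 * a + 2 by ring, unitState_two_mul_add_two, unitState_two_mul_add_one]
    simp only [cond_true, cond_false]
    linear_combination ih

lemma centralForm_unitState_add_two (k c : ℕ) :
    centralForm k (unitState k (c + 2)) + centralForm k (unitState k c) + k =
      (2 * k + 3) * centralForm k (unitState k (c + 1)) := by
  obtain ⟨a, rfl | rfl⟩ := c.even_or_odd'
  · have h := unitState_invariant k a
    rw [unitState_two_mul_add_two, unitState_two_mul_add_one]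
    simp only [centralForm, cond_true, cond_false]
    linear_combination k * h.symm
  · have h := unitState_invariant k a
    rw [show 2 * a + 1 + 2 = 2 * (a + 1) + 1 by ring, unitState_two_mul_add_one k (a + 1),
      show 2 * (a + 1) = 2 * a + 2 by ring, unitState_two_mul_add_two, unitState_two_mul_add_one]
    simp only [centralForm, cond_true, cond_false]
    linear_combination k * h.symm

theorem kMarkovNumber_zero_one (k : ℕ) : kMarkovNumber k 0 1 = 1 :=
  kMarkovNumber_of_add_le_one k le_rfl zero_le_one le_rfl

theorem kMarkovNumber_one_one (k : ℕ) : kMarkovNumber k 1 1 = k + 2 := by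
  have h := kMarkovNumber_unit k 0
  rw [unitState, fenceState_zero] at h
  simp only [Nat.cast_zero, zero_add, centralForm, Pi.one_apply] at h
  linarith

theorem kMarkovNumber_add_two_one (k n : ℕ) :
    kMarkovNumber k (n + 2) 1 + kMarkovNumber k n 1 + k =
      (2 * k + 3) * kMarkovNumber k (n + 1) 1 := by
  rw [show (n : ℤ) + 2 = (n + 1 : ℕ) + 1 by push_cast; ring, kMarkovNumber_unit, kMarkovNumber_unit]
  cases n with
  | zero =>
    have h := unitState_two_mul_add_one k 0
    simp only [mul_zero, unitState, fenceState_zero, Pi.one_apply] at h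
    rw [Nat.cast_zero, kMarkovNumber_zero_one, unitState, unitState, h, fenceState_zero]
    simp only [centralForm, Pi.one_apply, cond_true, cond_false]
    ring
  | succ n =>
    rw [Nat.cast_add_one, kMarkovNumber_unit]
    exact centralForm_unitState_add_two k n

end UnitSlope

section Diagonal

/-- The segments crossed by the segment from the origin to `(m + 2, m + 1)`. -/
def diagSegment (j : ℕ) : LatticeSegment :=
  match j % 4 with
  | 0 => ⟨(j / 4, j / 4 + 1), .antidiagonal⟩
  | 1 => ⟨(j / 4 + 1, j / 4), .vertical⟩
  | 2 => ⟨(j / 4 + 1, j / 4 + 1), .antidiagonal⟩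
  | _ => ⟨(j / 4 + 1, j / 4 + 1), .horizontal⟩

/-- The common endpoint of `diagSegment j` and `diagSegment (j + 1)`. -/
def diagPivot (j : ℕ) : ℤ × ℤ := ((j + 1) / 4 + 1, (j + 3) / 4)

lemma exists_eq_four_mul_add (j : ℕ) :
    ∃ a, j = 4 * a ∨ j = 4 * a + 1 ∨ j = 4 * a + 2 ∨ j = 4 * a + 3 :=
  ⟨j / 4, by omega⟩

lemma diagSegment_four_mul (a : ℕ) : diagSegment (4 * a) = ⟨(a, a + 1), .antidiagonal⟩ := by
  simp [diagSegment]

lemma diagSegment_four_mul_add_one (a : ℕ) :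
    diagSegment (4 * a + 1) = ⟨(a + 1, a), .vertical⟩ := by
  have : (4 * (a : ℤ) + 1) / 4 = a := by omega
  simp [diagSegment, Nat.add_mod, this]

lemma diagSegment_four_mul_add_two (a : ℕ) :
    diagSegment (4 * a + 2) = ⟨(a + 1, a + 1), .antidiagonal⟩ := by
  have : (4 * (a : ℤ) + 2) / 4 = a := by omega
  simp [diagSegment, Nat.add_mod, this]

lemma diagSegment_four_mul_add_three (a : ℕ) :
    diagSegment (4 * a + 3) = ⟨(a + 1, a + 1), .horizontal⟩ := by
  have : (4 * (a : ℤ) + 3) / 4 = a := by omega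
  simp [diagSegment, Nat.add_mod, this]

lemma diagSegment_src_add_tgt (j : ℕ) :
    (diagSegment j).src + (diagSegment j).tgt =
      (((j : ℤ) + 3) / 4 + (j + 2) / 4 + 1, ((j : ℤ) + 1) / 4 + j / 4 + 1) := by
  obtain ⟨a, rfl | rfl | rfl | rfl⟩ := exists_eq_four_mul_add j <;>
    simp only [diagSegment_four_mul, diagSegment_four_mul_add_one, diagSegment_four_mul_add_two,
      diagSegment_four_mul_add_three, LatticeSegment.tgt, Dir.vec, Prod.mk_add_mk,
      Prod.mk.injEq] <;>
    omega

lemma isCrossingSequence_diagSegment (m : ℕ) :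
    IsCrossingSequence (m + 2) (m + 1) (2 * (2 * m + 1)) diagSegment diagPivot where
  isCrossed j hj := by
    obtain ⟨a, rfl | rfl | rfl | rfl⟩ := exists_eq_four_mul_add j <;>
      simp only [diagSegment_four_mul, diagSegment_four_mul_add_one, diagSegment_four_mul_add_two,
        diagSegment_four_mul_add_three, LatticeSegment.IsCrossed, LeftOf, RightOf,
        LatticeSegment.tgt, Dir.level, Dir.vec, det, Prod.mk_add_mk] <;>
      ring_nf <;> omega
  complete d l hl hlt := by
    cases d <;> simp only [Dir.level] at hlt
    · refine ⟨4 * (l.toNat - 1) + 3, by omega, ?_⟩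
      simp only [diagSegment_four_mul_add_three, Dir.level, true_and]
      omega
    · refine ⟨4 * (l.toNat - 1) + 1, by omega, ?_⟩
      simp only [diagSegment_four_mul_add_one, Dir.level, true_and]
      omega
    · obtain ⟨a, rfl | rfl⟩ := l.even_or_odd'
      · refine ⟨4 * (a.toNat - 1) + 2, by omega, ?_⟩
        simp only [diagSegment_four_mul_add_two, Dir.level, true_and]
        omega
      · refine ⟨4 * a.toNat, by omega, ?_⟩
        simp only [diagSegment_four_mul, Dir.level, true_and]
        omega
  level_lt j hj := by
    obtain ⟨a, rfl | rfl | rfl | rfl⟩ := exists_eq_four_mul_add j <;>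
      simp only [diagSegment_four_mul, diagSegment_four_mul_add_one, diagSegment_four_mul_add_two,
        diagSegment_four_mul_add_three, show 4 * a + 3 + 1 = 4 * (a + 1) by ring, Dir.level] <;>
      push_cast <;> nlinarith
  dir_ne j hj := by
    obtain ⟨a, rfl | rfl | rfl | rfl⟩ := exists_eq_four_mul_add j <;>
      simp [diagSegment_four_mul, diagSegment_four_mul_add_one, diagSegment_four_mul_add_two,
        diagSegment_four_mul_add_three, show 4 * a + 3 + 1 = 4 * (a + 1) by ring]
  isEndpoint j hj := by
    obtain ⟨a, rfl | rfl | rfl | rfl⟩ := exists_eq_four_mul_add j <;>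
      simp only [diagPivot, diagSegment_four_mul, diagSegment_four_mul_add_one,
        diagSegment_four_mul_add_two, diagSegment_four_mul_add_three,
        show 4 * a + 3 + 1 = 4 * (a + 1) by ring, LatticeSegment.IsEndpoint, LatticeSegment.tgt,
        Dir.vec, Prod.mk_add_mk, Prod.mk.injEq] <;>
      omega

/-- The state of the first `n` blocks of the fence of `(m + 2, m + 1)`, for `n ≤ 2 * m + 1`. -/
abbrev diagState (k n : ℕ) : Bool → ℕ :=
  fenceState k (fun j => decide (j % 4 ≠ 0)) (fun j => decide (j % 4 = 1 ∨ j % 4 = 2)) n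

theorem kMarkovNumber_diag (k m : ℕ) :
    kMarkovNumber k (m + 2) (m + 1) = centralForm k (diagState k (2 * m + 1)) := by
  refine (isCrossingSequence_diagSegment m).kMarkovNumber_eq_centralForm (by omega) (by omega) k
    (fun r hr => ?_) (fun r hr => ?_) (fun r hr => ?_) fun r hr => ?_
  · simp only [diagSegment_src_add_tgt, Prod.mk_add_mk, Prod.mk.injEq]
    omega
  · simp only [diagPivot, Prod.mk_add_mk, Prod.mk.injEq]
    omega
  · obtain ⟨a, rfl | rfl | rfl | rfl⟩ := exists_eq_four_mul_add r <;>
      simp [diagSegment_four_mul, diagSegment_four_mul_add_one, diagSegment_four_mul_add_two,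
        diagSegment_four_mul_add_three, LeftOf, RightOf, LatticeSegment.tgt, Dir.vec, det,
        Nat.add_mod] <;> nlinarith
  · simp only [LeftOf, det, diagPivot, decide_eq_true_eq]
    by_cases h : r % 4 = 1 ∨ r % 4 = 2
    · refine iff_of_true ?_ h
      rw [show ((r : ℤ) + 3) / 4 = (r + 1) / 4 + 1 by omega]
      ring_nf
      omega
    · refine iff_of_false ?_ h
      rw [show ((r : ℤ) + 3) / 4 = (r + 1) / 4 by omega]
      ring_nf
      omega

lemma diagState_one (k : ℕ) : diagState k 1 = fun b => cond b (k + 2) 1 := by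
  rw [diagState, fenceState_succ, fenceState_zero]
  simp only [Nat.zero_mod, ne_eq, not_true_eq_false, decide_false, zero_ne_one, OfNat.zero_ne_ofNat,
    or_self, vecMul_transfer_false_pow, vecMul_transfer_false]
  ext b
  cases b <;> simp only [cond_true, cond_false, Pi.one_apply]
  ring

lemma diagState_four_mul_add_three (k a : ℕ) :
    diagState k (4 * a + 3) = fun b =>
      cond b (diagState k (4 * a + 1) true)
        (2 * (k + 1) * diagState k (4 * a + 1) true + diagState k (4 * a + 1) false) := by
  rw [diagState, fenceState_succ, fenceState_succ,
    show decide ((4 * a + 1) % 4 ≠ 0) = true from decide_eq_true (by omega),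
    show decide ((4 * a + 1 + 1) % 4 ≠ 0) = true from decide_eq_true (by omega),
    show decide ((4 * a + 1) % 4 = 1 ∨ (4 * a + 1) % 4 = 2) = true from decide_eq_true (by omega),
    show decide ((4 * a + 1 + 1) % 4 = 1 ∨ (4 * a + 1 + 1) % 4 = 2) = true from
      decide_eq_true (by omega)]
  simp only [vecMul_transfer_true_pow, vecMul_transfer_true]
  ext b
  cases b <;> simp only [cond_true, cond_false]
  ring

lemma diagState_four_mul_add_five (k a : ℕ) :
    diagState k (4 * a + 5) = fun b =>
      cond b (diagState k (4 * a + 3) true + (k + 2) *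
          (k * diagState k (4 * a + 3) true + diagState k (4 * a + 3) false))
        (k * diagState k (4 * a + 3) true + diagState k (4 * a + 3) false) := by
  rw [diagState, fenceState_succ, fenceState_succ,
    show decide ((4 * a + 3) % 4 ≠ 0) = true from decide_eq_true (by omega),
    show decide ((4 * a + 3 + 1) % 4 ≠ 0) = false from decide_eq_false (by omega),
    show decide ((4 * a + 3) % 4 = 1 ∨ (4 * a + 3) % 4 = 2) = false from
      decide_eq_false (by omega),
    show decide ((4 * a + 3 + 1) % 4 = 1 ∨ (4 * a + 3 + 1) % 4 = 2) = false from
      decide_eq_false (by omega)]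
  simp only [vecMul_transfer_true_pow, vecMul_transfer_false_pow, vecMul_transfer_false]
  ext b
  cases b <;> simp only [cond_true, cond_false]
  ring

lemma diagState_invariant (k a : ℕ) :
    (3 * k + 2) * diagState k (4 * a + 1) true ^ 2 + (k + 2) =
      (k + 2) * (3 * k + 2) * diagState k (4 * a + 1) true * diagState k (4 * a + 1) false +
        (k + 2) * diagState k (4 * a + 1) false ^ 2 := by
  induction a with
  | zero =>
    rw [mul_zero, zero_add, diagState_one]
    simp only [cond_true, cond_false]
    ring
  | succ a ih =>
    rw [show 4 * (a + 1) + 1 = 4 * a + 5 by ring, diagState_four_mul_add_five,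
      diagState_four_mul_add_three]
    simp only [cond_true, cond_false]
    linear_combination ih

lemma centralForm_diagState_add_four (k m : ℕ) :
    centralForm k (diagState k (2 * m + 5)) + centralForm k (diagState k (2 * m + 1)) +
        k * (k + 2) =
      (3 * k ^ 2 + 8 * k + 6) * centralForm k (diagState k (2 * m + 3)) := by
  obtain ⟨a, rfl | rfl⟩ := m.even_or_odd'
  · have h := diagState_invariant k a
    rw [show 2 * (2 * a) = 4 * a by ring, diagState_four_mul_add_five, diagState_four_mul_add_three]
    simp only [centralForm, cond_true, cond_false]
    linear_combination k * h
  · have h := diagState_invariant k a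
    rw [show 2 * (2 * a + 1) + 5 = 4 * (a + 1) + 3 by ring, diagState_four_mul_add_three k (a + 1),
      show 2 * (2 * a + 1) + 3 = 4 * a + 5 by ring, show 4 * (a + 1) + 1 = 4 * a + 5 by ring,
      show 2 * (2 * a + 1) + 1 = 4 * a + 3 by ring,
      diagState_four_mul_add_five, diagState_four_mul_add_three]
    simp only [centralForm, cond_true, cond_false]
    linear_combination k * h

theorem kMarkovNumber_one_zero (k : ℕ) : kMarkovNumber k 1 0 = 1 :=
  kMarkovNumber_of_add_le_one k zero_le_one le_rfl le_rfl

theorem kMarkovNumber_two_one (k : ℕ) : kMarkovNumber k 2 1 = 2 * k ^ 2 + 6 * k + 5 := by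
  have h := kMarkovNumber_diag k 0
  rw [mul_zero, zero_add, diagState_one] at h
  simp only [Nat.cast_zero, zero_add, centralForm, cond_true, cond_false] at h
  linarith

theorem kMarkovNumber_add_three_add_two (k n : ℕ) :
    kMarkovNumber k (n + 3) (n + 2) + kMarkovNumber k (n + 1) n + k * (k + 2) =
      (3 * k ^ 2 + 8 * k + 6) * kMarkovNumber k (n + 2) (n + 1) := by
  have hdiag := kMarkovNumber_diag k (n + 1)
  rw [show ((n + 1 : ℕ) : ℤ) + 2 = n + 3 by push_cast; ring,
    show ((n + 1 : ℕ) : ℤ) + 1 = n + 2 by push_cast; ring] at hdiag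
  rw [hdiag, kMarkovNumber_diag]
  cases n with
  | zero =>
    have h := diagState_four_mul_add_three k 0
    rw [mul_zero, zero_add, zero_add, diagState_one] at h
    rw [Nat.cast_zero, zero_add (1 : ℤ), kMarkovNumber_one_zero, mul_zero, zero_add,
      show 2 * 1 + 1 = 3 from rfl, h, diagState_one]
    simp only [centralForm, cond_true, cond_false]
    ring
  | succ n =>
    rw [show ((n + 1 : ℕ) : ℤ) + 1 = n + 2 by push_cast; ring, Nat.cast_add_one, kMarkovNumber_diag]
    exact centralForm_diagState_add_four k n

end Diagonal

section LinearRecurrence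

lemma eq_of_linear_recurrence {R : Type*} [CommRing R] {u : ℕ → R} {T e a b x y : R}
    (hu : ∀ n, u (n + 2) + u n + (T - 2) * e = T * u (n + 1))
    (hx : x ^ 2 = T * x - 1) (hy : y ^ 2 = T * y - 1)
    (h0 : u 0 = e + a + b) (h1 : u 1 = e + a * x + b * y) (n : ℕ) :
    u n = e + a * x ^ n + b * y ^ n := by
  induction n using Nat.twoStepInduction with
  | zero => simpa using h0
  | one => simpa using h1
  | more n ih ih' =>
    linear_combination hu n - ih + T * ih' - a * x ^ n * hx - b * y ^ n * hy

lemma tendsto_div_of_dominant {𝕜 : Type*} [NormedField 𝕜] {e a b x y : 𝕜} (ha : a ≠ 0)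
    (hx : 1 < ‖x‖) (hy : ‖y‖ < ‖x‖) :
    Tendsto (fun n : ℕ => (e + a * x ^ n + b * y ^ n) / (a * x ^ n)) atTop (𝓝 1) := by
  have hx0 : x ≠ 0 := norm_pos_iff.1 (zero_lt_one.trans hx)
  have hinv : Tendsto (fun n : ℕ => x⁻¹ ^ n) atTop (𝓝 0) :=
    tendsto_pow_atTop_nhds_zero_of_norm_lt_one (by simpa using inv_lt_one_of_one_lt₀ hx)
  have hratio : Tendsto (fun n : ℕ => (y / x) ^ n) atTop (𝓝 0) :=
    tendsto_pow_atTop_nhds_zero_of_norm_lt_one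
      (by rwa [norm_div, div_lt_one (zero_lt_one.trans hx)])
  have hsum : Tendsto (fun n : ℕ => 1 + (e / a * x⁻¹ ^ n + b / a * (y / x) ^ n)) atTop (𝓝 1) := by
    simpa using ((hinv.const_mul (e / a)).add (hratio.const_mul (b / a))).const_add 1
  refine hsum.congr fun n => ?_
  have hxn : x ^ n ≠ 0 := pow_ne_zero n hx0
  rw [inv_pow, div_pow]
  field_simp
  ring

lemma eq_and_tendsto_of_linear_recurrence {u : ℕ → ℝ} {T r e a b : ℝ} (hT : 2 < T) (hr : 0 < r)
    (hrT : r ^ 2 = T ^ 2 - 4) (ha : a ≠ 0)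
    (hu : ∀ n, u (n + 2) + u n + (T - 2) * e = T * u (n + 1))
    (h0 : u 0 = e + a + b) (h1 : u 1 = e + a * ((T + r) / 2) + b * ((T - r) / 2)) :
    (∀ n, u n = e + a * ((T + r) / 2) ^ n + b * ((T - r) / 2) ^ n) ∧
      Tendsto (fun n => u n / (a * ((T + r) / 2) ^ n)) atTop (𝓝 1) := by
  have hclosed := eq_of_linear_recurrence hu (by linear_combination hrT / 4)
    (by linear_combination hrT / 4) h0 h1
  have habs : |(T + r) / 2| = (T + r) / 2 := abs_of_pos (by linarith)
  refine ⟨hclosed, ?_⟩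
  simp only [hclosed]
  refine tendsto_div_of_dominant ha ?_ ?_
  · rw [Real.norm_eq_abs, habs]
    linarith
  · rw [Real.norm_eq_abs, Real.norm_eq_abs, habs]
    exact abs_lt.2 ⟨by linarith, by linarith⟩

theorem closedForm_of_unit_recurrence {k α : ℝ} {f : ℕ → ℝ} (hk : 0 ≤ k)
    (hα : α = 4 * k ^ 2 + 12 * k + 5) (h0 : f 0 = 1) (h1 : f 1 = k + 2)
    (hf : ∀ n, f (n + 2) + f n + k = (2 * k + 3) * f (n + 1)) :
    (∀ n, f n =
      k / (1 + 2 * k)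
      + (2 * k ^ 2 + 3 * k + 1 + (1 + k) * √α) / (2 * (1 + 2 * k) * √α)
          * ((3 + 2 * k + √α) / 2) ^ n
      + (-(2 * k ^ 2 + 3 * k + 1) + (1 + k) * √α) / (2 * (1 + 2 * k) * √α)
          * ((3 + 2 * k - √α) / 2) ^ n) ∧
    Tendsto (fun n => f n /
        ((2 * k ^ 2 + 3 * k + 1 + (1 + k) * √α) / (2 * (1 + 2 * k) * √α)
          * ((3 + 2 * k + √α) / 2) ^ n)) atTop (𝓝 1) := by
  have hα0 : 0 < α := by rw [hα]; positivity
  have hr0 : 0 < √α := Real.sqrt_pos.2 hα0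
  have hr : √α ^ 2 = (3 + 2 * k) ^ 2 - 4 := by
    rw [Real.sq_sqrt hα0.le, hα]
    ring
  have hk1 : 1 + 2 * k ≠ 0 := by positivity
  have hfix : (3 + 2 * k - 2) * (k / (1 + 2 * k)) = k := by
    field_simp
    ring
  refine eq_and_tendsto_of_linear_recurrence (by linarith) hr0 hr (by positivity) (fun n => ?_)
    ?_ ?_
  · rw [hfix, hf, add_comm (3 : ℝ)]
  · rw [h0]
    field_simp
    ring
  · rw [h1]
    field_simp
    ring

theorem closedForm_of_diag_recurrence {k β δ : ℝ} {g : ℕ → ℝ} (hk : 0 ≤ k)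
    (hβ : β = 3 * k ^ 2 + 8 * k + 6)
    (hδ : δ = 3 * k ^ 4 + 17 * k ^ 3 + 34 * k ^ 2 + 28 * k + 8)
    (h0 : g 0 = 1) (h1 : g 1 = 2 * k ^ 2 + 6 * k + 5)
    (hg : ∀ n, g (n + 2) + g n + k * (k + 2) = (3 * k ^ 2 + 8 * k + 6) * g (n + 1)) :
    (∀ n, g n =
      k / (3 * k + 2)
      + ((k + 1) * (k + 2) * (β ^ 2 - 4) + δ * √(β ^ 2 - 4)) / ((β - 2) * (β ^ 2 - 4))
          * ((β + √(β ^ 2 - 4)) / 2) ^ n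
      + ((k + 1) * (k + 2) * (β ^ 2 - 4) - δ * √(β ^ 2 - 4)) / ((β - 2) * (β ^ 2 - 4))
          * ((β - √(β ^ 2 - 4)) / 2) ^ n) ∧
    Tendsto (fun n => g n /
        (((k + 1) * (k + 2) * (β ^ 2 - 4) + δ * √(β ^ 2 - 4)) / ((β - 2) * (β ^ 2 - 4))
          * ((β + √(β ^ 2 - 4)) / 2) ^ n)) atTop (𝓝 1) := by
  have hβ2 : β - 2 = (3 * k + 2) * (k + 2) := by rw [hβ]; ring
  have hβ6 : 6 ≤ β := by rw [hβ]; nlinarith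
  have hδ0 : 0 < δ := by rw [hδ]; positivity
  have hpos : 0 < β ^ 2 - 4 := by nlinarith
  have hr0 : 0 < √(β ^ 2 - 4) := Real.sqrt_pos.2 hpos
  have hr : √(β ^ 2 - 4) ^ 2 = β ^ 2 - 4 := Real.sq_sqrt hpos.le
  have hfix : (3 * k + 2) * (k + 2) * (k / (3 * k + 2)) = k * (k + 2) := by field_simp
  generalize √(β ^ 2 - 4) = r at hr hr0 ⊢
  rw [← hr, hβ2]
  refine eq_and_tendsto_of_linear_recurrence (by linarith) hr0 hr (by positivity) (fun n => ?_)
    ?_ ?_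
  · rw [hβ2, hfix, hg, hβ]
  · rw [h0]
    field_simp
    ring
  · rw [h1]
    field_simp
    rw [hδ, hβ]
    ring

end LinearRecurrence

end KMarkov

theorem proposition4p1 (k : ℕ) :
    -- the sequence `f n = m^{(k)}_{1/n}`
    (∀ (f : ℕ → ℝ) (_ : ∀ n : ℕ, f n = (kMarkovNumber k (n : ℤ) 1 : ℝ))
        (α : ℝ) (_ : α = 4 * (k : ℝ) ^ 2 + 12 * k + 5),
      f 0 = 1 ∧ f 1 = k + 2 ∧
      (∀ n : ℕ, 2 ≤ n → f n = (2 * k + 3) * f (n - 1) - f (n - 2) - k) ∧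
      (∀ n : ℕ, f n =
        k / (1 + 2 * k)
        + (2 * (k : ℝ) ^ 2 + 3 * k + 1 + (1 + k) * √α) / (2 * (1 + 2 * k) * √α)
            * ((3 + 2 * k + √α) / 2) ^ n
        + (-(2 * (k : ℝ) ^ 2 + 3 * k + 1) + (1 + k) * √α) / (2 * (1 + 2 * k) * √α)
            * ((3 + 2 * k - √α) / 2) ^ n) ∧
      Tendsto (fun n : ℕ => f n /
          ((2 * (k : ℝ) ^ 2 + 3 * k + 1 + (1 + k) * √α) / (2 * (1 + 2 * k) * √α)
            * ((3 + 2 * k + √α) / 2) ^ n)) atTop (𝓝 1)) ∧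
    -- the sequence `g n = m^{(k)}_{n/(n+1)}`
    (∀ (g : ℕ → ℝ) (_ : ∀ n : ℕ, g n = (kMarkovNumber k ((n : ℤ) + 1) (n : ℤ) : ℝ))
        (β δ : ℝ) (_ : β = 3 * (k : ℝ) ^ 2 + 8 * k + 6)
        (_ : δ = 3 * (k : ℝ) ^ 4 + 17 * (k : ℝ) ^ 3 + 34 * (k : ℝ) ^ 2 + 28 * k + 8),
      g 0 = 1 ∧ g 1 = 2 * (k : ℝ) ^ 2 + 6 * k + 5 ∧
      (∀ n : ℕ, 2 ≤ n →
        g n = (3 * (k : ℝ) ^ 2 + 8 * k + 6) * g (n - 1) - g (n - 2) - k * (k + 2)) ∧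
      (∀ n : ℕ, g n =
        k / (3 * k + 2)
        + ((k + 1) * (k + 2) * (β ^ 2 - 4) + δ * √(β ^ 2 - 4)) / ((β - 2) * (β ^ 2 - 4))
            * ((β + √(β ^ 2 - 4)) / 2) ^ n
        + ((k + 1) * (k + 2) * (β ^ 2 - 4) - δ * √(β ^ 2 - 4)) / ((β - 2) * (β ^ 2 - 4))
            * ((β - √(β ^ 2 - 4)) / 2) ^ n) ∧
      Tendsto (fun n : ℕ => g n /
          (((k + 1) * (k + 2) * (β ^ 2 - 4) + δ * √(β ^ 2 - 4)) / ((β - 2) * (β ^ 2 - 4))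
            * ((β + √(β ^ 2 - 4)) / 2) ^ n)) atTop (𝓝 1)) := by
  refine ⟨fun f hf α hα => ?_, fun g hg β δ hβ hδ => ?_⟩
  · have h0 : f 0 = 1 := by rw [hf, Nat.cast_zero, KMarkov.kMarkovNumber_zero_one, Nat.cast_one]
    have h1 : f 1 = k + 2 := by rw [hf, Nat.cast_one, KMarkov.kMarkovNumber_one_one]; norm_cast
    have hrec (n : ℕ) : f (n + 2) + f n + k = (2 * k + 3) * f (n + 1) := by
      simp only [hf]
      exact_mod_cast KMarkov.kMarkovNumber_add_two_one k n
    refine ⟨h0, h1, fun n hn => ?_,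
      KMarkov.closedForm_of_unit_recurrence k.cast_nonneg hα h0 h1 hrec⟩
    obtain ⟨m, rfl⟩ := Nat.exists_eq_add_of_le' hn
    change f (m + 2) = (2 * k + 3) * f (m + 1) - f m - k
    linarith [hrec m]
  · have h0 : g 0 = 1 := by
      rw [hg, Nat.cast_zero, zero_add, KMarkov.kMarkovNumber_one_zero, Nat.cast_one]
    have h1 : g 1 = 2 * (k : ℝ) ^ 2 + 6 * k + 5 := by
      rw [hg, Nat.cast_one, one_add_one_eq_two, KMarkov.kMarkovNumber_two_one]
      norm_cast
    have hrec (n : ℕ) : g (n + 2) + g n + k * (k + 2) =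
        (3 * (k : ℝ) ^ 2 + 8 * k + 6) * g (n + 1) := by
      simp only [hg]
      exact_mod_cast KMarkov.kMarkovNumber_add_three_add_two k n
    refine ⟨h0, h1, fun n hn => ?_,
      KMarkov.closedForm_of_diag_recurrence k.cast_nonneg hβ hδ h0 h1 hrec⟩
    obtain ⟨m, rfl⟩ := Nat.exists_eq_add_of_le' hn
    change g (m + 2) = (3 * (k : ℝ) ^ 2 + 8 * k + 6) * g (m + 1) - g m - k * (k + 2)
    linarith [hrec m]
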